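/- Theorem. Let $\mathcal X$ be a topological space with its Borel $\sigma$-algebra, and let $k\colon\mathcal X\times\mathcal X\to\mathbb R$ be a symmetric, positive semidefinite kernel that is continuous, bounded and jointly measurable (measurability being automatic if $\mathcal X$ is second countable), with reproducing kernel Hilbert space $(\mathcal H_k,\|\cdot\|_k)$. Let $\rho$ be a probability measure on $\mathcal X\times\mathbb R$, let $(X,f)$ have law $\rho$ with $\mathbb E f^2<\infty$, let $P=\rho(\cdot\times\mathbb R)$ be the law of $X$, and put $Kw(x)=\int_{\mathcal X}k(x,y)\,w(y)\,P(dy)$. Suppose that the function $f_0\colon\mathcal X\to\mathbb R$ satisfies $f_0(X)=\mathbb E(f\mid X)$ almost surely and $f_0=Kw_0$ everywhere on $\mathcal X$ for some $w_0\in\mathcal H_k$. Let $(X_i,f_i)$, $i=1,2,\dots$, be independent with law $\rho$, and let $\lambda_n>0$ be deterministic with $\lambda_n\to0$ and $n\lambda_n^3\to\infty$. Let $$\hat f_n=\frac1n\sum_{i=1}^n \hat w_i\,k(\cdot,X_i),\qquad\text{where}\qquad \lambda_n\hat w_i+\frac1n\sum_{j=1}^n k(X_i,X_j)\,\hat w_j=f_i,\quad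 i=1,\dots,n.$$ Then $f_0\in\mathcal H_k$ and $\|\hat f_n-f_0\|_k\to0$ in probability as $n\to\infty$. Further, for every $x\in\mathcal X$, $\hat f_n(x)\to f_0(x)$ in probability. -/

import Mathlib

open MeasureTheory ProbabilityTheory Filter Topology
open scoped Matrix

noncomputable section

namespace KernelRegression

/-- The integral operator `(K w)(x) = ∫ k(x, y) w(y) P(dy)` associated with a kernel `k` and a
design measure `P`. -/
def kernelOp {X : Type*} [MeasurableSpace X] (k : X → X → ℝ) (P : Measure X) (w : X → ℝ) (x : X) :
    ℝ :=
  ∫ y, k x y * w y ∂P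

/-- The Gram matrix `(k(xᵢ, xⱼ))ᵢⱼ` of the design points `x₀, …, xₙ₋₁`. -/
def gram {X : Type*} {n : ℕ} (k : X → X → ℝ) (x : Fin n → X) : Matrix (Fin n) (Fin n) ℝ :=
  Matrix.of fun i j => k (x i) (x j)

/-- The weights `ŵ = (lam + (1/n) k(x, x))⁻¹ f`, that is, for a positive semidefinite kernel `k`
and `lam > 0`, the solution of `lam ŵᵢ + (1/n) ∑ⱼ k(xᵢ, xⱼ) ŵⱼ = fᵢ`, `i = 0, …, n - 1`. -/
def weights {X : Type*} {n : ℕ} (k : X → X → ℝ) (lam : ℝ) (x : Fin n → X) (f : Fin n → ℝ) :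
    Fin n → ℝ :=
  (lam • (1 : Matrix (Fin n) (Fin n) ℝ) + (1 / (n : ℝ)) • gram k x)⁻¹ *ᵥ f

/-- The kernel ridge regression estimator `f̂ₙ = (1/n) ∑ᵢ ŵᵢ k(·, xᵢ)` as an element of the
reproducing kernel Hilbert space `H` with kernel `k`; `RKHS.kerFun H y 1` is the kernel section
`k(·, y)` as an element of `H`. -/
def estimator {X : Type*} (H : Type*) [NormedAddCommGroup H] [InnerProductSpace ℝ H]
    [CompleteSpace H] [RKHS ℝ H X ℝ] {n : ℕ} (k : X → X → ℝ) (lam : ℝ) (x : Fin n → X)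
    (f : Fin n → ℝ) : H :=
  (1 / (n : ℝ)) • ∑ i, weights k lam x f i • RKHS.kerFun H (x i) 1

end KernelRegression

end

/-! Write `φ(x) = k(·, x)` and let `Tₙ` and `T` be the empirical and population covariance
operators. On `H` the operator `T` acts as `K`, so `T w₀ = f₀` and `f₀` lies in `H`. The estimator
`e` solves `(lam + Tₙ) e = (1/n) ∑ fᵢ φ(Xᵢ)`. Comparing it with `f₀ - lam w₀` instead of `f₀`, the
difference `u` satisfies `(lam + Tₙ) u = N + lam² w₀ + lam D`, where `N` averages the noise `(fᵢ -
f₀(Xᵢ)) φ(Xᵢ)` and `D = Tₙ w₀ - f₀`. As `Tₙ ≥ 0`, dividing by `lam` bounds the error by `‖N‖ / lam +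
2 lam ‖w₀‖ + ‖D‖` (`norm_estimator_sub_le`); no operator norm of `Tₙ - T` enters.

Both `N` and `D` are averages of centered i.i.d. vectors, so their mean squares are `O(1/n)`
(`integral_norm_sq_average`). The mean squared error is thus `O(1/(n lam²) + lam² + 1/n)`, and
Markov's inequality concludes. -/

namespace KernelRegression

open scoped RealInnerProductSpace

/-! ### Probabilistic tools -/

/-- Square-integrable centered i.i.d. Hilbert-space valued variables obey the law of large numbers
in mean square at rate `1 / n`; only the inner products `⟪G z, G z'⟫` need be measurable. -/
theorem integral_norm_sq_average {Z E Ω : Type*} [MeasurableSpace Z] [MeasurableSpace Ω]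
    [NormedAddCommGroup E] [InnerProductSpace ℝ E] {ρ : Measure Z} [IsProbabilityMeasure ρ]
    {μ : Measure Ω} [IsProbabilityMeasure μ] {G : Z → E}
    (hmeas : Measurable fun p : Z × Z => ⟪G p.1, G p.2⟫)
    (hmean : ∀ h : E, ∫ z, ⟪G z, h⟫ ∂ρ = 0) (hint : Integrable (fun z => ‖G z‖ ^ 2) ρ)
    {Zs : ℕ → Ω → Z} (hlaw : ∀ i, HasLaw (Zs i) ρ μ) (hindep : iIndepFun Zs μ) (n : ℕ) :
    Integrable (fun ω => ‖(1 / (n : ℝ)) • ∑ i : Fin n, G (Zs i ω)‖ ^ 2) μ ∧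
      ∫ ω, ‖(1 / (n : ℝ)) • ∑ i : Fin n, G (Zs i ω)‖ ^ 2 ∂μ =
        (1 / (n : ℝ)) * ∫ z, ‖G z‖ ^ 2 ∂ρ := by
  have hnorm : MemLp (fun z => ‖G z‖) 2 ρ := by
    refine (memLp_two_iff_integrable_sq ?_).2 hint
    have h : Measurable fun z => √⟪G z, G z⟫ := (hmeas.comp (measurable_id.prodMk measurable_id)).sqrt
    simpa only [← norm_eq_sqrt_real_inner] using h.aestronglyMeasurable
  have hprod : Integrable (fun p : Z × Z => ⟪G p.1, G p.2⟫) (ρ.prod ρ) :=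
    ((hnorm.integrable one_le_two).mul_prod (hnorm.integrable one_le_two)).mono'
      hmeas.aestronglyMeasurable (ae_of_all _ fun p => norm_inner_le_norm _ _)
  have hdiag (i : ℕ) : Integrable (fun ω => ⟪G (Zs i ω), G (Zs i ω)⟫) μ ∧
      ∫ ω, ⟪G (Zs i ω), G (Zs i ω)⟫ ∂μ = ∫ z, ‖G z‖ ^ 2 ∂ρ := by
    simp only [real_inner_self_eq_norm_sq]
    have h := hint
    rw [← (hlaw i).map_eq] at h
    refine ⟨h.comp_aemeasurable (hlaw i).aemeasurable, ?_⟩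
    exact (hlaw i).integral_comp hint.aestronglyMeasurable
  have hoff {i j : ℕ} (hij : i ≠ j) : Integrable (fun ω => ⟪G (Zs i ω), G (Zs j ω)⟫) μ ∧
      ∫ ω, ⟪G (Zs i ω), G (Zs j ω)⟫ ∂μ = 0 := by
    have hpair : HasLaw (fun ω => (Zs i ω, Zs j ω)) (ρ.prod ρ) μ :=
      ⟨(hlaw i).aemeasurable.prodMk (hlaw j).aemeasurable, by
        rw [(indepFun_iff_map_prod_eq_prod_map_map (hlaw i).aemeasurable
          (hlaw j).aemeasurable).1 (hindep.indepFun hij), (hlaw i).map_eq, (hlaw j).map_eq]⟩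
    have h := hprod
    rw [← hpair.map_eq] at h
    refine ⟨h.comp_aemeasurable hpair.aemeasurable, ?_⟩
    refine (hpair.integral_comp hprod.aestronglyMeasurable).trans ?_
    -- Fubini, integrating the first variable first, where centering applies.
    rw [integral_prod_symm _ hprod]
    simp [hmean]
  have hall (i j : Fin n) : Integrable (fun ω => ⟪G (Zs i ω), G (Zs j ω)⟫) μ ∧
      ∫ ω, ⟪G (Zs i ω), G (Zs j ω)⟫ ∂μ = if i = j then ∫ z, ‖G z‖ ^ 2 ∂ρ else 0 := by
    split_ifs with h
    · subst h; exact hdiag i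
    · exact hoff fun h' => h (Fin.ext h')
  have hexp : (fun ω => ‖(1 / (n : ℝ)) • ∑ i : Fin n, G (Zs i ω)‖ ^ 2) = fun ω =>
      (1 / (n : ℝ)) ^ 2 * ∑ i : Fin n, ∑ j : Fin n, ⟪G (Zs i ω), G (Zs j ω)⟫ := by
    ext ω
    rw [norm_smul, mul_pow, Real.norm_eq_abs, sq_abs, ← real_inner_self_eq_norm_sq, sum_inner]
    simp_rw [inner_sum]
  rw [hexp]
  refine ⟨(integrable_finsetSum _ fun i _ => integrable_finsetSum _ fun j _ =>
    (hall i j).1).const_mul _, ?_⟩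
  rw [integral_const_mul, integral_finsetSum _ fun i _ => integrable_finsetSum _ fun j _ =>
    (hall i j).1]
  simp_rw [integral_finsetSum _ fun j _ => (hall _ j).1, (hall _ _).2]
  -- For `n = 0` both sides vanish, since `1 / 0 = 0`.
  rcases eq_or_ne (n : ℝ) 0 with hn | hn
  · simp [hn]
  · simp
    field_simp

/-- A sequence whose squared distance to the limit is eventually dominated by integrable functions
with integrals tending to zero converges in measure. -/
theorem tendstoInMeasure_of_sq_le {Ω E : Type*} [MeasurableSpace Ω] [SeminormedAddCommGroup E]
    {μ : Measure Ω} [IsFiniteMeasure μ] {Y : ℕ → Ω → E} {y : E} {S : ℕ → Ω → ℝ}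
    (hS : ∀ n, Integrable (S n) μ) (hS_zero : Tendsto (fun n => ∫ ω, S n ω ∂μ) atTop (𝓝 0))
    (hle : ∀ᶠ n in atTop, ∀ ω, ‖Y n ω - y‖ ^ 2 ≤ S n ω) :
    TendstoInMeasure μ Y atTop fun _ => y := by
  rw [tendstoInMeasure_iff_measureReal_norm]
  intro ε hε
  have hlim : Tendsto (fun n => (∫ ω, S n ω ∂μ) / ε ^ 2) atTop (𝓝 0) := by
    simpa using hS_zero.div_const (ε ^ 2)
  refine tendsto_of_tendsto_of_tendsto_of_le_of_le' tendsto_const_nhds hlim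
    (Eventually.of_forall fun n => measureReal_nonneg) ?_
  filter_upwards [hle] with n hn
  rw [le_div_iff₀' (by positivity)]
  refine le_trans ?_ (mul_meas_ge_le_integral_of_nonneg
    (ae_of_all _ fun ω => (sq_nonneg _).trans (hn ω)) (hS n) (ε ^ 2))
  refine mul_le_mul_of_nonneg_left (measureReal_mono fun ω (h : ε ≤ _) => ?_) (by positivity)
  exact (pow_le_pow_left₀ hε.le h 2).trans (hn ω)

/-! ### Deterministic error analysis in the RKHS -/

section RKHS

variable {X H : Type*} [NormedAddCommGroup H] [InnerProductSpace ℝ H] [CompleteSpace H]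
  [RKHS ℝ H X ℝ] {k : X → X → ℝ}

theorem inner_kerFun_kerFun (hH : ∀ x y, RKHS.kernel H x y 1 = k x y) (x y : X) :
    ⟪RKHS.kerFun H x (1 : ℝ), RKHS.kerFun H y 1⟫ = k x y := by
  rw [RKHS.kerFun_inner, RKHS.kerFun_apply, hH]
  simp

theorem weights_equation (hH : ∀ x y, RKHS.kernel H x y 1 = k x y) {n : ℕ} {lam : ℝ}
    (hlam : 0 < lam) (x : Fin n → X) (f : Fin n → ℝ) (i : Fin n) :
    lam * weights k lam x f i + (1 / (n : ℝ)) * ∑ j, k (x i) (x j) * weights k lam x f j =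
      f i := by
  have hpsd : (gram k x).PosSemidef := by
    have : gram k x = Matrix.gram ℝ fun i => RKHS.kerFun H (x i) (1 : ℝ) := by
      ext i j
      simp only [gram, Matrix.of_apply, Matrix.gram_apply, inner_kerFun_kerFun hH]
    exact this ▸ Matrix.posSemidef_gram ℝ _
  have hpd : (lam • (1 : Matrix (Fin n) (Fin n) ℝ) + (1 / (n : ℝ)) • gram k x).PosDef :=
    (Matrix.PosDef.one.smul hlam).add_posSemidef (hpsd.smul (by positivity))
  have h : (lam • (1 : Matrix (Fin n) (Fin n) ℝ) + (1 / (n : ℝ)) • gram k x) *ᵥ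
      weights k lam x f = f := by
    rw [weights, Matrix.mulVec_mulVec, Matrix.mul_nonsing_inv _ hpd.det_pos.ne'.isUnit,
      Matrix.one_mulVec]
  have hi := congrFun h i
  rw [Matrix.add_mulVec, Matrix.smul_mulVec, Matrix.smul_mulVec, Matrix.one_mulVec] at hi
  exact hi

/-- The regularized normal equation `(lam + Tₙ) f̂ = (1/n) ∑ᵢ fᵢ k(·, xᵢ)`, where `Tₙ` is the
empirical covariance operator. -/
theorem estimator_equation (hH : ∀ x y, RKHS.kernel H x y 1 = k x y) {n : ℕ} {lam : ℝ}
    (hlam : 0 < lam) (x : Fin n → X) (f : Fin n → ℝ) :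
    lam • estimator H k lam x f +
        (1 / (n : ℝ)) • ∑ i, estimator H k lam x f (x i) • RKHS.kerFun H (x i) (1 : ℝ) =
      (1 / (n : ℝ)) • ∑ i, f i • RKHS.kerFun H (x i) (1 : ℝ) := by
  have heval (i : Fin n) : estimator H k lam x f (x i) =
      (1 / (n : ℝ)) * ∑ j, k (x i) (x j) * weights k lam x f j := by
    have h : ⟪RKHS.kerFun H (x i) (1 : ℝ), estimator H k lam x f⟫ = estimator H k lam x f (x i) := by
      simp
    rw [← h]
    simp only [estimator, inner_smul_right, inner_sum, inner_kerFun_kerFun hH, mul_comm]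
  simp_rw [heval]
  conv_lhs => enter [1]; rw [estimator, smul_comm]
  rw [← smul_add, Finset.smul_sum, ← Finset.sum_add_distrib]
  congr 1
  refine Finset.sum_congr rfl fun i _ => ?_
  rw [smul_smul, ← add_smul, weights_equation hH hlam]

/-- Deterministic bound on the estimation error in terms of the averaged noise, the bias and the
sampling error of the covariance operator at `w₀`. -/
theorem norm_estimator_sub_le (hH : ∀ x y, RKHS.kernel H x y 1 = k x y) {n : ℕ} (hn : n ≠ 0)
    {lam : ℝ} (hlam : 0 < lam) (x : Fin n → X) (f : Fin n → ℝ) (g w : H) :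
    ‖estimator H k lam x f - g‖ ≤
      ‖(1 / (n : ℝ)) • ∑ i, (f i - g (x i)) • RKHS.kerFun H (x i) (1 : ℝ)‖ / lam +
        2 * lam * ‖w‖ +
        ‖(1 / (n : ℝ)) • ∑ i, (w (x i) • RKHS.kerFun H (x i) (1 : ℝ) - g)‖ := by
  have heq := estimator_equation hH hlam x f
  set e := estimator H k lam x f
  set N := (1 / (n : ℝ)) • ∑ i, (f i - g (x i)) • RKHS.kerFun H (x i) (1 : ℝ) with hN
  set D := (1 / (n : ℝ)) • ∑ i, (w (x i) • RKHS.kerFun H (x i) (1 : ℝ) - g) with hD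
  -- The shift by `lam • w` makes the term `-lam • g` combine with `lam • Tₙ w` into `lam • D`.
  set u := e - g + lam • w with hu
  have hg : (1 / (n : ℝ)) • ∑ _i : Fin n, g = g := by
    have : (n : ℝ) ≠ 0 := by exact_mod_cast hn
    rw [Finset.sum_const, Finset.card_univ, Fintype.card_fin, ← Nat.cast_smul_eq_nsmul ℝ, smul_smul,
      one_div_mul_cancel this, one_smul]
  have hu_eq : lam • u + (1 / (n : ℝ)) • ∑ i, u (x i) • RKHS.kerFun H (x i) (1 : ℝ) =
      N + lam ^ 2 • w + lam • D := by
    have hux (i : Fin n) : u (x i) = e (x i) - g (x i) + lam * w (x i) := by simp [hu]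
    simp_rw [hux, add_smul, sub_smul, mul_smul]
    rw [hN, hD]
    simp_rw [sub_smul]
    simp only [Finset.sum_add_distrib, Finset.sum_sub_distrib, smul_add, smul_sub, hg,
      ← Finset.smul_sum] at heq ⊢
    rw [← heq, hu]
    module
  -- Positivity of `Tₙ`: the inner product is `(1/n) ∑ u(xᵢ)²`.
  have hpos : 0 ≤ ⟪(1 / (n : ℝ)) • ∑ i, u (x i) • RKHS.kerFun H (x i) (1 : ℝ), u⟫ := by
    rw [real_inner_smul_left, sum_inner]
    refine mul_nonneg (by positivity) (Finset.sum_nonneg fun i _ => ?_)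
    rw [real_inner_smul_left, RKHS.kerFun_inner]
    simpa using mul_self_nonneg (u (x i))
  have hmain : lam * ‖u‖ ^ 2 ≤ (‖N‖ + lam ^ 2 * ‖w‖ + lam * ‖D‖) * ‖u‖ := by
    calc lam * ‖u‖ ^ 2 = ⟪lam • u, u⟫ := by
          rw [real_inner_smul_left, real_inner_self_eq_norm_sq]
      _ ≤ ⟪N + lam ^ 2 • w + lam • D, u⟫ := by
          rw [← hu_eq, inner_add_left]; linarith
      _ ≤ ‖N + lam ^ 2 • w + lam • D‖ * ‖u‖ := real_inner_le_norm _ _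
      _ ≤ _ := by
          gcongr
          refine (norm_add₃_le).trans_eq ?_
          rw [norm_smul lam D, norm_smul _ w, Real.norm_of_nonneg hlam.le,
            Real.norm_of_nonneg (by positivity)]
  have hu_le : ‖u‖ ≤ ‖N‖ / lam + lam * ‖w‖ + ‖D‖ := by
    rcases (norm_nonneg u).eq_or_lt with h | h
    · rw [← h]; positivity
    · have h1 : lam * ‖u‖ ≤ ‖N‖ + lam ^ 2 * ‖w‖ + lam * ‖D‖ :=
        le_of_mul_le_mul_right (by linarith) h
      rw [← mul_le_mul_iff_right₀ hlam]
      refine h1.trans_eq ?_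
      field_simp
  calc ‖e - g‖ = ‖u - lam • w‖ := by rw [hu, add_sub_cancel_right]
    _ ≤ ‖u‖ + ‖lam • w‖ := norm_sub_le _ _
    _ = ‖u‖ + lam * ‖w‖ := by rw [norm_smul, Real.norm_of_nonneg hlam.le]
    _ ≤ _ := by linarith

/-! ### Regularity, integrability and centering -/

theorem norm_kerFun_one_sq (hH : ∀ x y, RKHS.kernel H x y 1 = k x y) (x : X) :
    ‖RKHS.kerFun H x (1 : ℝ)‖ ^ 2 = k x x := by
  rw [← real_inner_self_eq_norm_sq, inner_kerFun_kerFun hH]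

theorem norm_apply_le_mul_sqrt (hH : ∀ x y, RKHS.kernel H x y 1 = k x y) {B : ℝ}
    (hB : ∀ x y, |k x y| ≤ B) (h : H) (x : X) : ‖h x‖ ≤ ‖h‖ * √B := by
  have h1 : ⟪h, RKHS.kerFun H x (1 : ℝ)⟫ = h x := by simp
  rw [← h1]
  refine (norm_inner_le_norm _ _).trans ?_
  gcongr
  exact Real.le_sqrt_of_sq_le ((norm_kerFun_one_sq hH x).trans_le ((le_abs_self _).trans (hB x x)))

/-- Expanding `‖φ(x) - φ(x₀)‖²` in kernel values shows that the feature map `φ` is continuous, and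
evaluation is pairing with `φ`. This makes elements of `H` Borel measurable. -/
theorem continuous_apply [TopologicalSpace X] (hH : ∀ x y, RKHS.kernel H x y 1 = k x y)
    (hk : Continuous (Function.uncurry k)) (h : H) : Continuous h := by
  have hφ : Continuous fun x => RKHS.kerFun H x (1 : ℝ) := by
    rw [continuous_iff_continuousAt]
    intro x₀
    have hsq : Tendsto (fun x => ‖RKHS.kerFun H x (1 : ℝ) - RKHS.kerFun H x₀ 1‖ ^ 2) (𝓝 x₀)
        (𝓝 0) := by
      have hc : Continuous fun x => k x x - 2 * k x x₀ + k x₀ x₀ := by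
        have h1 : Continuous fun x => k x x := hk.comp (continuous_id.prodMk continuous_id)
        have h2 : Continuous fun x => k x x₀ := hk.comp (continuous_id.prodMk continuous_const)
        fun_prop
      have := hc.tendsto x₀
      rw [show k x₀ x₀ - 2 * k x₀ x₀ + k x₀ x₀ = 0 by ring] at this
      refine this.congr fun x => ?_
      rw [norm_sub_sq_real, inner_kerFun_kerFun hH, norm_kerFun_one_sq hH, norm_kerFun_one_sq hH]
    rw [ContinuousAt, tendsto_iff_norm_sub_tendsto_zero]
    simpa using hsq.sqrt
  have h1 : (h : X → ℝ) = fun x => ⟪h, RKHS.kerFun H x (1 : ℝ)⟫ := by ext x; simp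
  rw [h1]
  fun_prop

/-- The image of `w` under the covariance operator of the design measure `P`. -/
theorem exists_forall_inner_eq_integral [TopologicalSpace X] [MeasurableSpace X] [BorelSpace X]
    (hH : ∀ x y, RKHS.kernel H x y 1 = k x y) (hk : Continuous (Function.uncurry k)) {B : ℝ}
    (hB : ∀ x y, |k x y| ≤ B) (P : Measure X) [IsFiniteMeasure P] (w : H) :
    ∃ g : H, ∀ h : H, ⟪g, h⟫ = ∫ x, w x * h x ∂P := by
  have hbd (h : H) (x : X) : ‖w x * h x‖ ≤ ‖w‖ * √B * (‖h‖ * √B) := by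
    rw [norm_mul]
    gcongr
    · exact norm_apply_le_mul_sqrt hH hB w x
    · exact norm_apply_le_mul_sqrt hH hB h x
  have hint (h : H) : Integrable (fun x => w x * h x) P :=
    .of_bound ((continuous_apply hH hk w).measurable.mul
      (continuous_apply hH hk h).measurable).aestronglyMeasurable _ (ae_of_all _ (hbd h))
  let L : H →ₗ[ℝ] ℝ :=
    { toFun := fun h => ∫ x, w x * h x ∂P
      map_add' := fun h₁ h₂ => by
        simp only [RKHS.coe_add, Pi.add_apply, mul_add]
        exact integral_add (hint h₁) (hint h₂)
      map_smul' := fun c h => by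
        simp only [RKHS.coe_smul, Pi.smul_apply, smul_eq_mul, mul_left_comm _ c,
          integral_const_mul, RingHom.id_apply] }
  -- Riesz representation replaces a Bochner integral of `w(x) φ(x)`.
  refine ⟨(InnerProductSpace.toDual ℝ H).symm
    (L.mkContinuous (‖w‖ * √B * √B * P.real Set.univ) fun h => ?_), fun h => ?_⟩
  · refine (norm_integral_le_of_norm_le_const (ae_of_all _ (hbd h))).trans_eq ?_
    ring
  · simp [L]

theorem integrable_mul_norm_kerFun_sq [MeasurableSpace X] {Z : Type*} [MeasurableSpace Z]
    (hH : ∀ x y, RKHS.kernel H x y 1 = k x y) (hk : Measurable (Function.uncurry k)) {B : ℝ}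
    (hB : ∀ x y, |k x y| ≤ B) {ρ : Measure Z} {a : Z → ℝ} (ha : MemLp a 2 ρ) {p : Z → X}
    (hp : Measurable p) :
    Integrable (fun z => ‖a z • RKHS.kerFun H (p z) (1 : ℝ)‖ ^ 2) ρ := by
  simp_rw [norm_smul, mul_pow, norm_kerFun_one_sq hH, Real.norm_eq_abs, sq_abs]
  exact ha.integrable_sq.mul_bdd (c := B)
    (hk.comp (hp.prodMk hp)).aestronglyMeasurable (ae_of_all _ fun z => hB _ _)

/-- The residual `f - E(f | X)` is orthogonal to bounded measurable functions of `X`. -/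
theorem integral_sub_condExp_fst_mul_eq_zero [MeasurableSpace X] {ρ : Measure (X × ℝ)}
    [IsProbabilityMeasure ρ] (hρ : MemLp (fun z : X × ℝ => z.2) 2 ρ) {f₀ : X → ℝ}
    (hf₀ : (fun z : X × ℝ => f₀ z.1) =ᵐ[ρ]
      ρ[(fun z : X × ℝ => z.2) | MeasurableSpace.comap (Prod.fst : X × ℝ → X) inferInstance])
    {h : X → ℝ} (hh : Measurable h) {C : ℝ} (hC : ∀ x, ‖h x‖ ≤ C) :
    ∫ z, (z.2 - f₀ z.1) * h z.1 ∂ρ = 0 := by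
  have hm : MeasurableSpace.comap (Prod.fst : X × ℝ → X) inferInstance ≤
      (inferInstance : MeasurableSpace (X × ℝ)) := measurable_fst.comap_le
  have hint : Integrable (fun z : X × ℝ => z.2) ρ := hρ.integrable one_le_two
  have hhm : StronglyMeasurable[MeasurableSpace.comap (Prod.fst : X × ℝ → X) inferInstance]
      fun z : X × ℝ => h z.1 :=
    (hh.comp (comap_measurable (Prod.fst : X × ℝ → X))).stronglyMeasurable
  have hint₀ : Integrable (fun z : X × ℝ => f₀ z.1) ρ := integrable_condExp.congr hf₀.symm
  have hbdd {u : X × ℝ → ℝ} (hu : Integrable u ρ) : Integrable (fun z => h z.1 * u z) ρ :=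
    hu.bdd_mul (c := C) (hhm.mono hm).aestronglyMeasurable (ae_of_all _ fun z => hC z.1)
  have hpull := condExp_mul_of_stronglyMeasurable_left hhm (hbdd hint) hint
  have hz : ∫ z, h z.1 * z.2 ∂ρ = ∫ z, h z.1 * f₀ z.1 ∂ρ := by
    rw [← integral_condExp hm]
    refine integral_congr_ae ?_
    filter_upwards [hpull, hf₀] with z h1 h2
    rw [h2]
    exact h1
  calc ∫ z, (z.2 - f₀ z.1) * h z.1 ∂ρ = ∫ z, (h z.1 * z.2 - h z.1 * f₀ z.1) ∂ρ := by
        congr with z; ring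
    _ = 0 := by rw [integral_sub (hbdd hint) (hbdd hint₀), hz, sub_self]

end RKHS

theorem add_add_sq_le_three_mul (a b c : ℝ) : (a + b + c) ^ 2 ≤ 3 * (a ^ 2 + b ^ 2 + c ^ 2) := by
  linarith [sq_nonneg (a - b), sq_nonneg (a - c), sq_nonneg (b - c)]

/-- The quantity equals `lam · (n lam³)⁻¹`, a product of two null sequences. -/
theorem tendsto_one_div_mul_sq {lam : ℕ → ℝ} (hlam_pos : ∀ n, 1 ≤ n → 0 < lam n)
    (hlam_zero : Tendsto lam atTop (𝓝 0))
    (hlam_rate : Tendsto (fun n : ℕ => (n : ℝ) * lam n ^ 3) atTop atTop) :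
    Tendsto (fun n : ℕ => 1 / (n : ℝ) / lam n ^ 2) atTop (𝓝 0) := by
  have h := hlam_zero.mul hlam_rate.inv_tendsto_atTop
  rw [zero_mul] at h
  refine h.congr' ?_
  filter_upwards [eventually_ge_atTop 1] with n hn
  have := (hlam_pos n hn).ne'
  have : (n : ℝ) ≠ 0 := by positivity
  simp only [Pi.inv_apply]
  field_simp

end KernelRegression

/-! ### Consistency of the estimator -/

open scoped RealInnerProductSpace

theorem mainTheorem9
    {X : Type*} [TopologicalSpace X] [MeasurableSpace X] [BorelSpace X]
    -- `k` is a continuous, bounded (and jointly measurable) kernel, `H` is its RKHS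
    (k : X → X → ℝ) (hk_cont : Continuous (Function.uncurry k))
    (hk_meas : Measurable (Function.uncurry k)) (hk_bdd : ∃ B : ℝ, ∀ x y, |k x y| ≤ B)
    {H : Type*} [NormedAddCommGroup H] [InnerProductSpace ℝ H] [CompleteSpace H]
    [RKHS ℝ H X ℝ] (hH : ∀ x y, RKHS.kernel H x y 1 = k x y)
    -- the law `ρ` of `(X, f)`, with `f` square integrable, and `f₀(X) = E(f | X)`, `f₀ = K w₀`
    (ρ : Measure (X × ℝ)) [IsProbabilityMeasure ρ] (hρ : MemLp (fun z : X × ℝ => z.2) 2 ρ)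
    (f₀ : X → ℝ)
    (hf₀ : (fun z : X × ℝ => f₀ z.1) =ᵐ[ρ]
      ρ[(fun z : X × ℝ => z.2) | MeasurableSpace.comap (Prod.fst : X × ℝ → X) inferInstance])
    (w₀ : H) (hw₀ : ∀ x, f₀ x = KernelRegression.kernelOp k ρ.fst w₀ x)
    -- the sample: independent pairs `(Xᵢ, fᵢ)` with law `ρ`
    {Ω : Type*} [MeasurableSpace Ω] (μ : Measure Ω) [IsProbabilityMeasure μ]
    (Xs : ℕ → Ω → X) (fs : ℕ → Ω → ℝ)
    (hlaw : ∀ i, HasLaw (fun ω => (Xs i ω, fs i ω)) ρ μ)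
    (hindep : iIndepFun (fun i ω => (Xs i ω, fs i ω)) μ)
    -- the regularization parameters
    (lam : ℕ → ℝ) (hlam_pos : ∀ n, 1 ≤ n → 0 < lam n) (hlam_zero : Tendsto lam atTop (𝓝 0))
    (hlam_rate : Tendsto (fun n : ℕ => (n : ℝ) * lam n ^ 3) atTop atTop) :
    ∃ g₀ : H, (∀ x, g₀ x = f₀ x) ∧
      TendstoInMeasure μ
        (fun (n : ℕ) ω => KernelRegression.estimator H k (lam n)
          (fun i : Fin n => Xs i ω) (fun i : Fin n => fs i ω))
        atTop (fun _ => g₀) ∧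
      ∀ x, TendstoInMeasure μ
        (fun (n : ℕ) ω => KernelRegression.estimator H k (lam n)
          (fun i : Fin n => Xs i ω) (fun i : Fin n => fs i ω) x)
        atTop (fun _ => f₀ x) := by
  obtain ⟨B, hB⟩ := hk_bdd
  have hmeas (h : H) : Measurable h := (KernelRegression.continuous_apply hH hk_cont h).measurable
  have hbdd (h : H) (x : X) : ‖h x‖ ≤ ‖h‖ * √B :=
    KernelRegression.norm_apply_le_mul_sqrt hH hB h x
  obtain ⟨g, hg⟩ := KernelRegression.exists_forall_inner_eq_integral hH hk_cont hB ρ.fst w₀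
  -- Testing the Riesz vector against `φ(x)` yields `K w₀ (x)`.
  have hgf (x : X) : g x = f₀ x := by
    have h := hg (RKHS.kerFun H x (1 : ℝ))
    rw [RKHS.inner_kerFun] at h
    rw [hw₀, KernelRegression.kernelOp]
    refine (by simp : g x = ⟪g x, (1 : ℝ)⟫).trans (h.trans ?_)
    congr with y
    have hsymm : k y x = k x y := by
      rw [← KernelRegression.inner_kerFun_kerFun hH, real_inner_comm,
        KernelRegression.inner_kerFun_kerFun hH]
    rw [RKHS.kerFun_apply, hH, hsymm, mul_comm]
  obtain rfl : g = f₀ := funext hgf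
  have hL2 (h : H) : MemLp (fun z : X × ℝ => h z.1) 2 ρ :=
    .of_bound ((hmeas h).comp measurable_fst).aestronglyMeasurable _ (ae_of_all _ fun z => hbdd h z.1)
  have hkm : Measurable fun p : (X × ℝ) × (X × ℝ) => k p.1.1 p.2.1 :=
    hk_meas.comp ((measurable_fst.comp measurable_fst).prodMk (measurable_fst.comp measurable_snd))
  -- the averaged noise
  let G : X × ℝ → H := fun z => (z.2 - g z.1) • RKHS.kerFun H z.1 (1 : ℝ)
  have hG := KernelRegression.integral_norm_sq_average (G := G) (ρ := ρ) (by
      simp only [G, real_inner_smul_left, real_inner_smul_right,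
        KernelRegression.inner_kerFun_kerFun hH]
      have := hmeas g
      fun_prop) (fun h => by
      simp only [G, real_inner_smul_left, RKHS.kerFun_inner, RCLike.inner_apply, map_one, mul_one]
      exact KernelRegression.integral_sub_condExp_fst_mul_eq_zero hρ hf₀ (hmeas h) (hbdd h))
    (KernelRegression.integrable_mul_norm_kerFun_sq hH hk_meas hB (hρ.sub (hL2 g)) measurable_fst)
    hlaw hindep
  -- the sampling error of the covariance operator
  let D : X × ℝ → H := fun z => w₀ z.1 • RKHS.kerFun H z.1 (1 : ℝ) - g
  have hDinner (h : H) (z : X × ℝ) : ⟪D z, h⟫ = w₀ z.1 * h z.1 - ⟪g, h⟫ := by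
    simp [D, inner_sub_left, real_inner_smul_left]
  have hwh (h : H) : Integrable (fun z : X × ℝ => w₀ z.1 * h z.1) ρ := (hL2 w₀).integrable_mul (hL2 h)
  have hD := KernelRegression.integral_norm_sq_average (G := D) (ρ := ρ) (by
      -- Scalar form of the inner product, whose measurability follows from that of `k`, `w₀` and
      -- `g`.
      have h1 (p : (X × ℝ) × (X × ℝ)) : ⟪D p.1, D p.2⟫ =
          w₀ p.1.1 * (w₀ p.2.1 * k p.1.1 p.2.1 - g p.1.1) - (w₀ p.2.1 * g p.2.1 - ⟪g, g⟫) := by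
        have h2 : D p.2 p.1.1 = w₀ p.2.1 * k p.1.1 p.2.1 - g p.1.1 := by
          simp [D, RKHS.kerFun_apply, hH]
        rw [hDinner, h2, real_inner_comm, hDinner]
      simp only [h1]
      have := hmeas g
      have := hmeas w₀
      fun_prop) (fun h => by
      have h1 : ∫ z, w₀ z.1 * h z.1 ∂ρ = ⟪g, h⟫ := by
        rw [hg]
        exact (integral_map measurable_fst.aemeasurable
          ((hmeas w₀).mul (hmeas h)).aestronglyMeasurable).symm
      simp only [hDinner]
      rw [integral_sub (hwh h) (integrable_const _), h1]
      simp) (by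
      have h1 (z : X × ℝ) : ‖D z‖ ^ 2 = ‖w₀ z.1 • RKHS.kerFun H z.1 (1 : ℝ)‖ ^ 2
          - 2 * (w₀ z.1 * g z.1) + ‖g‖ ^ 2 := by
        rw [norm_sub_sq_real, real_inner_smul_left, RKHS.kerFun_inner]
        simp
      simp only [h1]
      exact ((KernelRegression.integrable_mul_norm_kerFun_sq hH hk_meas hB (hL2 w₀)
        measurable_fst).sub ((hwh g).const_mul 2)).add (integrable_const _))
    hlaw hindep
  let S : ℕ → Ω → ℝ := fun n ω =>
    3 * (‖(1 / (n : ℝ)) • ∑ i : Fin n, G (Xs i ω, fs i ω)‖ ^ 2 / lam n ^ 2 +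
      (2 * lam n * ‖w₀‖) ^ 2 + ‖(1 / (n : ℝ)) • ∑ i : Fin n, D (Xs i ω, fs i ω)‖ ^ 2)
  have hS (n : ℕ) : Integrable (S n) μ :=
    ((((hG n).1.div_const _).add (integrable_const _)).add (hD n).1).const_mul 3
  have hS_zero : Tendsto (fun n => ∫ ω, S n ω ∂μ) atTop (𝓝 0) := by
    have hval (n : ℕ) : ∫ ω, S n ω ∂μ = 3 * (1 / (n : ℝ) / lam n ^ 2 * (∫ z, ‖G z‖ ^ 2 ∂ρ) +
        (2 * lam n * ‖w₀‖) ^ 2 + 1 / (n : ℝ) * ∫ z, ‖D z‖ ^ 2 ∂ρ) := by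
      have h1 := (hG n).1.div_const (lam n ^ 2)
      have h2 : Integrable (fun _ : Ω => (2 * lam n * ‖w₀‖) ^ 2) μ := integrable_const _
      have h12 := integral_add h1 h2
      have h123 := integral_add (h1.add h2) (hD n).1
      simp only [Pi.add_apply] at h123
      rw [integral_const_mul, h123, h12, integral_div, (hG n).2, (hD n).2]
      simp only [integral_const, probReal_univ, one_smul]
      ring
    simp only [hval]
    have h1 := (KernelRegression.tendsto_one_div_mul_sq hlam_pos hlam_zero hlam_rate).mul_const
      (∫ z, ‖G z‖ ^ 2 ∂ρ)
    have h2 := ((hlam_zero.const_mul 2).mul_const ‖w₀‖).pow 2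
    have h3 := (tendsto_one_div_atTop_nhds_zero_nat (𝕜 := ℝ)).mul_const (∫ z, ‖D z‖ ^ 2 ∂ρ)
    simpa using ((h1.add h2).add h3).const_mul 3
  have hle (n : ℕ) (hn : 1 ≤ n) (ω : Ω) :
      ‖KernelRegression.estimator H k (lam n) (fun i : Fin n => Xs i ω)
        (fun i : Fin n => fs i ω) - g‖ ^ 2 ≤ S n ω := by
    have h := KernelRegression.norm_estimator_sub_le hH (by lia) (hlam_pos n hn)
      (fun i : Fin n => Xs i ω) (fun i : Fin n => fs i ω) g w₀
    refine (pow_le_pow_left₀ (norm_nonneg _) h 2).trans ?_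
    simp only [S, ← div_pow]
    exact KernelRegression.add_add_sq_le_three_mul _ _ _
  refine ⟨g, fun _ => rfl, ?_, fun x => ?_⟩
  · exact KernelRegression.tendstoInMeasure_of_sq_le hS hS_zero
      (eventually_atTop.2 ⟨1, hle⟩)
  -- Evaluation at `x` has squared norm at most `B`, so the same bound serves up to this factor.
  · refine KernelRegression.tendstoInMeasure_of_sq_le (S := fun n ω => S n ω * B)
      (fun n => (hS n).mul_const B) ?_ (eventually_atTop.2 ⟨1, fun n hn ω => ?_⟩)
    · simpa only [integral_mul_const, zero_mul] using hS_zero.mul_const B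
    · have hB0 : 0 ≤ B := (abs_nonneg _).trans (hB x x)
      rw [← Pi.sub_apply, ← RKHS.coe_sub]
      refine (pow_le_pow_left₀ (norm_nonneg _) (hbdd _ x) 2).trans ?_
      rw [mul_pow, Real.sq_sqrt hB0]
      exact mul_le_mul_of_nonneg_right (hle n hn ω) hB0
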